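/- Let $R$ be an associative ring with unit. An $\mathcal R$-module (respectively, a right $\mathcal R$-module) is a covariant additive functor from the category of left (respectively, right) $R$-modules to the category of abelian groups; morphisms are natural transformations, and $\operatorname{Hom}_{\mathcal R}$ and $\operatorname{Ext}_{\mathcal R}^i$ are taken in the abelian category of $\mathcal R$-modules. For a right $R$-module $M$ let $\mathcal M$ be the $\mathcal R$-module $\mathcal M(S)=M\otimes_R S$, and for a left $R$-module $S$ let $\mathcal S$ be the right $\mathcal R$-module $\mathcal S(N)=N\otimes_R S$. The dual of an $\mathcal R$-module $\mathbb M$ is the right $\mathcal R$-module $\mathbb M^*(N)=\operatorname{Hom}_{\mathcal R}(\mathbb M,\mathcal N)$; the dual of a right $\mathcal R$-module $\mathbb N$ is the $\mathcal R$-module $\mathbb N^*(S)=\operatorname{Hom}_{\mathcal R}(\mathbb N,\mathcal S)$. (If these Homs are not small, duals are regarded as functors to abelian groups of the next universe.) An $\mathcal R$-module $\mathbb M$ is reflexive if the natural morphism $\mathbb M\to\mathbb M^{**}$, $m\mapsto\tilde m$ for $m\in\mathbb M(S)$, where $\tilde m_N(w)=w_S(m)$ for $w\in\mathbb M^*(N)$,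 is an isomorphism. An FP module is an $\mathcal R$-module that preserves direct limits (over all upward directed sets) and direct products (over all sets). Theorem. Let $\mathbb F$ be an FP module. Then $\mathbb F$ is reflexive, and $$\operatorname{Ext}_{\mathcal R}^i(\mathbb F,\mathcal M)=0\quad\text{for every } i>0 \text{ and every right } R\text{-module } M.$$ -/

import Mathlib

open CategoryTheory CategoryTheory.Limits Opposite
open scoped TensorProduct

universe v u

/-! ### The abelian category of additive functors -/

namespace AddFun

variable {C D : Type*} [Category* C] [Category* D] [Preadditive C] [Abelian D]

instance : (additiveFunctor C D).IsClosedUnderSubobjects where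
  prop_of_mono {X Y} f _ hY := by
    have : Y.Additive := hY
    refine ⟨fun {A B a b} => ?_⟩
    rw [← cancel_mono (f.app B)]
    simp [Preadditive.add_comp]

instance : (additiveFunctor C D).IsClosedUnderQuotients where
  prop_of_epi {X Y} f _ hX := by
    have : X.Additive := hX
    refine ⟨fun {A B a b} => ?_⟩
    rw [← cancel_epi (f.app A)]
    simp [Preadditive.comp_add, ← NatTrans.naturality, Preadditive.add_comp]

instance : (additiveFunctor C D).ContainsZero where
  exists_zero := ⟨_, isZero_zero (C ⥤ D), Functor.Additive.of_isZero (isZero_zero (C ⥤ D))⟩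

instance : (additiveFunctor C D).IsClosedUnderFiniteProducts where
  isClosedUnderLimitsOfShape J _ := ⟨by
    rintro X ⟨p⟩
    have hp : ∀ j, (p.diag.obj j).Additive := p.prop_diag_obj
    refine ⟨fun {A B a b} => ?_⟩
    refine (isLimitOfPreserves ((evaluation C D).obj B) p.isLimit).hom_ext fun j => ?_
    simp [Preadditive.add_comp]⟩

end AddFun

/-! ### Functors of modules -/

/-- `RFun R` is the category of `𝓡`-modules: covariant additive functors from the category of (left)
`R`-modules to the category of abelian groups. A right `R`-module is a module over `Rᵐᵒᵖ`, so
that `RFun Rᵐᵒᵖ` is the category of right `𝓡`-modules. Usually the groups live in the same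
universe as the modules (`v = u`); as the morphisms between two such functors form a type in the
next universe, dual functors have `v = u + 1`. -/
abbrev RFun (R : Type u) [Ring R] := ModuleCat.{u} R ⥤+ AddCommGrpCat.{v}

instance (R : Type u) [Ring R] : HasExt.{u + 1} (RFun.{u} R) :=
  HasExt.standard _

namespace RFun

variable {R : Type u} [Ring R]

/-- An `𝓡`-module with `u`-small values, regarded as one with values in the next universe. -/
def lift : RFun.{u} R ⥤ RFun.{u + 1} R where
  obj F := AdditiveFunctor.of (F.obj ⋙ AddCommGrpCat.uliftFunctor.{u + 1, u})
  map α := ObjectProperty.homMk (Functor.whiskerRight α.hom _)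

instance : (lift (R := R)).Additive where
  map_add := by
    intros
    ext
    rfl

/-! ### The tensor product over a non-commutative ring -/

section Tensor

/-- The relations `m r ⊗ s = m ⊗ r s`. -/
def balancedRel (M : ModuleCat.{u} Rᵐᵒᵖ) (S : ModuleCat.{u} R) : AddSubgroup (M ⊗[ℤ] S) :=
  AddSubgroup.closure
    {x | ∃ (m : M) (r : R) (s : S), x = (MulOpposite.op r • m) ⊗ₜ[ℤ] s - m ⊗ₜ[ℤ] (r • s)}

/-- The abelian group `M ⊗_R S`, for a right `R`-module `M` and a left `R`-module `S`. -/
abbrev Tens (M : ModuleCat.{u} Rᵐᵒᵖ) (S : ModuleCat.{u} R) : Type u :=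
  (M ⊗[ℤ] S) ⧸ balancedRel M S

/-- The element `m ⊗ s` of `M ⊗_R S`. -/
def tmk {M : ModuleCat.{u} Rᵐᵒᵖ} {S : ModuleCat.{u} R} (m : M) (s : S) : Tens M S :=
  QuotientAddGroup.mk (m ⊗ₜ[ℤ] s)

theorem Tens.hom_ext {M : ModuleCat.{u} Rᵐᵒᵖ} {S : ModuleCat.{u} R} {A : Type*} [AddCommGroup A]
    {f g : Tens M S →+ A} (h : ∀ m s, f (tmk m s) = g (tmk m s)) : f = g := by
  refine QuotientAddGroup.addMonoidHom_ext _ (DFunLike.ext _ _ fun x => ?_)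
  induction x using TensorProduct.induction_on with
  | zero => simp
  | tmul m s => exact h m s
  | add x y hx hy => rw [map_add, map_add, hx, hy]

/-- The additive map `f ⊗ g : M ⊗_R S → M' ⊗_R S'`. -/
def tmap {M M' : ModuleCat.{u} Rᵐᵒᵖ} {S S' : ModuleCat.{u} R} (f : M ⟶ M') (g : S ⟶ S') :
    Tens M S →+ Tens M' S' :=
  QuotientAddGroup.map _ _
    (TensorProduct.map f.hom.toAddMonoidHom.toIntLinearMap
      g.hom.toAddMonoidHom.toIntLinearMap).toAddMonoidHom (by
    rw [balancedRel, AddSubgroup.closure_le]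
    rintro _ ⟨m, r, s, rfl⟩
    refine AddSubgroup.subset_closure ⟨f m, r, g s, ?_⟩
    simp)

@[simp]
theorem tmap_tmk {M M' : ModuleCat.{u} Rᵐᵒᵖ} {S S' : ModuleCat.{u} R} (f : M ⟶ M')
    (g : S ⟶ S') (m : M) (s : S) : tmap f g (tmk m s) = tmk (f m) (g s) := rfl

theorem add_tmk {M : ModuleCat.{u} Rᵐᵒᵖ} {S : ModuleCat.{u} R} (m m' : M) (s : S) :
    tmk (m + m') s = tmk m s + tmk m' s := by
  simp only [tmk, TensorProduct.add_tmul]; rfl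

theorem tmk_add {M : ModuleCat.{u} Rᵐᵒᵖ} {S : ModuleCat.{u} R} (m : M) (s s' : S) :
    tmk m (s + s') = tmk m s + tmk m s' := by
  simp only [tmk, TensorProduct.tmul_add]; rfl

end Tensor

/-! ### Quasi-coherent modules -/

/-- `M ↦ (S ↦ M ⊗_R S)`: the quasi-coherent `𝓡`-module associated with a right `R`-module. -/
def quasiCoherent (R : Type u) [Ring R] : ModuleCat.{u} Rᵐᵒᵖ ⥤ RFun.{u} R where
  obj M :=
    { obj :=
        { obj S := AddCommGrpCat.of (Tens M S)
          map g := AddCommGrpCat.ofHom (tmap (𝟙 M) g)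
          map_id _ := AddCommGrpCat.hom_ext (Tens.hom_ext fun _ _ => rfl)
          map_comp _ _ := AddCommGrpCat.hom_ext (Tens.hom_ext fun _ _ => rfl) }
      property :=
        { map_add := AddCommGrpCat.hom_ext (Tens.hom_ext fun _ _ => tmk_add _ _ _) } }
  map f := ObjectProperty.homMk
    { app S := AddCommGrpCat.ofHom (tmap f (𝟙 S))
      naturality _ _ _ := AddCommGrpCat.hom_ext (Tens.hom_ext fun _ _ => rfl) }
  map_id _ := by
    ext S : 3
    exact AddCommGrpCat.hom_ext (Tens.hom_ext fun _ _ => rfl)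
  map_comp _ _ := by
    ext S : 3
    exact AddCommGrpCat.hom_ext (Tens.hom_ext fun _ _ => rfl)

instance : (quasiCoherent R).Additive where
  map_add := by
    intros
    ext S : 3
    exact AddCommGrpCat.hom_ext (Tens.hom_ext fun _ _ => add_tmk _ _ _)

/-- `S ↦ (N ↦ N ⊗_R S)`: the quasi-coherent right `𝓡`-module associated with a left `R`-module. -/
def quasiCoherentRight (R : Type u) [Ring R] : ModuleCat.{u} R ⥤ RFun.{u} Rᵐᵒᵖ where
  obj S :=
    { obj :=
        { obj N := AddCommGrpCat.of (Tens N S)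
          map f := AddCommGrpCat.ofHom (tmap f (𝟙 S))
          map_id _ := AddCommGrpCat.hom_ext (Tens.hom_ext fun _ _ => rfl)
          map_comp _ _ := AddCommGrpCat.hom_ext (Tens.hom_ext fun _ _ => rfl) }
      property :=
        { map_add := AddCommGrpCat.hom_ext (Tens.hom_ext fun _ _ => add_tmk _ _ _) } }
  map g := ObjectProperty.homMk
    { app N := AddCommGrpCat.ofHom (tmap (𝟙 N) g)
      naturality _ _ _ := AddCommGrpCat.hom_ext (Tens.hom_ext fun _ _ => rfl) }
  map_id _ := by
    ext S : 3
    exact AddCommGrpCat.hom_ext (Tens.hom_ext fun _ _ => rfl)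
  map_comp _ _ := by
    ext S : 3
    exact AddCommGrpCat.hom_ext (Tens.hom_ext fun _ _ => rfl)

instance : (quasiCoherentRight R).Additive where
  map_add := by
    intros
    ext S : 3
    exact AddCommGrpCat.hom_ext (Tens.hom_ext fun _ _ => tmk_add _ _ _)

/-! ### Duals and reflexive functors -/

/-- For `𝕄` in a preadditive category, the additive functor `Hom(𝕄, -)`. -/
def homFrom {𝒜 : Type*} [Category.{v} 𝒜] [Preadditive 𝒜] (M : 𝒜) : 𝒜 ⥤ AddCommGrpCat.{v} where
  obj N := AddCommGrpCat.of (M ⟶ N)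
  map f := AddCommGrpCat.ofHom (Preadditive.rightComp M f)
  map_id _ := by
    ext
    exact Category.comp_id _
  map_comp _ _ := by
    ext
    exact (Category.assoc _ _ _).symm

instance {𝒜 : Type*} [Category.{v} 𝒜] [Preadditive 𝒜] (M : 𝒜) : (homFrom M).Additive where
  map_add := by
    intros
    ext
    exact Preadditive.comp_add _ _ _ _ _ _

/-- The dual right `𝓡`-module `𝕄^*` of an `𝓡`-module: `𝕄^*(N) = Hom_𝓡(𝕄, 𝓝)`. -/
def dual (M : RFun.{u + 1} R) : RFun.{u + 1} Rᵐᵒᵖ :=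
  AdditiveFunctor.of (quasiCoherent R ⋙ lift ⋙ homFrom M)

/-- The dual left `𝓡`-module of a right `𝓡`-module. -/
def dualRight (N : RFun.{u + 1} Rᵐᵒᵖ) : RFun.{u + 1} R :=
  AdditiveFunctor.of (quasiCoherentRight R ⋙ lift ⋙ homFrom N)

/-- For `m ∈ 𝕄(S)`, the morphism `m̃ : 𝕄^* → 𝓢`, `m̃_N(w) = w_S(m)` for `w : 𝕄 → 𝓝`. -/
def evalAt (M : RFun.{u + 1} R) (S : ModuleCat.{u} R) (m : M.obj.obj S) :
    M.dual ⟶ lift.obj ((quasiCoherentRight R).obj S) :=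
  ObjectProperty.homMk
    { app N := AddCommGrpCat.ofHom
        (AddMonoidHom.mk' (fun w : M ⟶ lift.obj ((quasiCoherent R).obj N) =>
          (w.hom.app S).hom m) fun _ _ => rfl)
      naturality _ _ _ := rfl }

theorem dual_hom_ext {M : RFun.{u + 1} R} {P : RFun.{u + 1} Rᵐᵒᵖ} {f g : M.dual ⟶ P}
    (h : ∀ (N : ModuleCat.{u} Rᵐᵒᵖ) (w : M ⟶ lift.obj ((quasiCoherent R).obj N)),
      (f.hom.app N).hom w = (g.hom.app N).hom w) : f = g := by
  ext N w
  exact h N w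

/-- The natural morphism `𝕄 → 𝕄^{**}`, `m ↦ m̃`. -/
def toBidual (M : RFun.{u + 1} R) : M ⟶ M.dual.dualRight :=
  ObjectProperty.homMk
    { app S := AddCommGrpCat.ofHom (AddMonoidHom.mk' (evalAt M S) fun m m' =>
        dual_hom_ext fun _ w => map_add (w.hom.app S).hom m m')
      naturality _ _ f := AddCommGrpCat.hom_ext <| AddMonoidHom.ext fun m =>
        dual_hom_ext fun _ w => congr($(w.hom.naturality f).hom m) }

/-- `𝕄` is reflexive if the natural morphism `𝕄 → 𝕄^{**}` is an isomorphism. -/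
def IsReflexive (M : RFun.{u + 1} R) : Prop :=
  IsIso M.toBidual

/-! ### FP modules -/

/-- `𝕄` preserves direct limits over all upward directed sets. -/
def PreservesDirectLimits (M : RFun.{v} R) : Prop :=
  ∀ (I : Type u) [Preorder I] [IsDirectedOrder I] [Nonempty I], PreservesColimitsOfShape I M.obj

/-- `𝕄` preserves direct products over all sets. -/
def PreservesDirectProducts (M : RFun.{v} R) : Prop :=
  ∀ I : Type u, PreservesLimitsOfShape (Discrete I) M.obj

/-- An FP module is an `𝓡`-module that preserves direct limits and direct products. -/
structure IsFP (F : RFun.{u} R) : Prop where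
  preservesDirectLimits : F.PreservesDirectLimits
  preservesDirectProducts : F.PreservesDirectProducts

end RFun

/-!
An FP module `F` is the cokernel of a morphism `Hom(B', -) → Hom(B, -)` with `B` and `B'` finitely
presented. Indeed, `F` preserves products, so all elements of all `F(A)` with `A` finitely
presented are the coordinates of a single element of `F(∏ A)`; `F` preserves direct limits, so
this element comes from an element `b` of `F(B)` for a finitely presented `B`, and `b` generates
`F`. The kernel of `Hom(B, -) → F` again satisfies the two conditions used, so it is generated in
the same way.

If `D → X → Y` is exact, `X` is a quotient of a representable functor and `Y` a cokernel of a
morphism between representable functors, then every morphism from `D` to a right exact functor `T`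
that vanishes on the kernel of `D → X` extends to `X`. For `0 → K → Hom(B, -) → F → 0` this is
`Ext¹(F, T) = 0`, and the higher groups vanish by dimension shifting, because `K` is the cokernel
of a morphism between representable functors as well.

Write `𝓑` for `N ↦ N ⊗ B`. For `F^* → 𝓑 → 𝓑'` and `T = 𝓢` the extension property says that every
element of `F^{**}(S)` comes from a morphism `𝓑 → 𝓢`, that is, from a morphism `p : B → S`, hence
from the element `p b` of `F(S)`. If `p b` is zero in `F^{**}(S)`, then `𝓑 → 𝓢` vanishes on the
kernel `F^*` of `𝓑 → 𝓑'`, so it extends to `𝓑'` by the same property of `𝓑 → 𝓑' → 𝓒`, where `C` is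
the cokernel of `B → B'`; hence `p` factors through `B → B'` and `p b = 0`.
-/

namespace AddFun

variable {C D : Type*} [Category* C] [Category* D] [Preadditive C] [Abelian D]

instance : PreservesFiniteLimits (additiveFunctor C D).ι := by
  have := (additiveFunctor C D).preservesKernels_ι
  exact Functor.preservesFiniteLimits_of_preservesKernels _

instance : PreservesFiniteColimits (additiveFunctor C D).ι := by
  have := (additiveFunctor C D).preservesCokernels_ι
  exact Functor.preservesFiniteColimits_of_preservesCokernels _

end AddFun

namespace RFun

variable {R : Type u} [Ring R]

section Elements

variable {F G H : RFun.{v} R} {A B C : ModuleCat.{u} R}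

/-- The additive map `F(A) → F(B)` induced by `f : A → B`. Stating identities between elements
in terms of it avoids the concrete-category coercions. -/
def act (F : RFun.{v} R) (f : A ⟶ B) : F.obj.obj A →+ F.obj.obj B := (F.obj.map f).hom

/-- The component `F(A) → G(A)` of a morphism of functors, as an additive map. -/
def component (w : F ⟶ G) (A : ModuleCat.{u} R) : F.obj.obj A →+ G.obj.obj A := (w.hom.app A).hom

theorem act_id (x : F.obj.obj A) : F.act (𝟙 A) x = x :=
  congr($(F.obj.map_id A).hom x)

theorem act_comp (f : A ⟶ B) (g : B ⟶ C) (x : F.obj.obj A) :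
    F.act (f ≫ g) x = F.act g (F.act f x) :=
  congr($(F.obj.map_comp f g).hom x)

theorem add_act (f g : A ⟶ B) (x : F.obj.obj A) : F.act (f + g) x = F.act f x + F.act g x := by
  exact congr($(F.obj.map_add (f := f) (g := g)).hom x)

theorem sub_act (f g : A ⟶ B) (x : F.obj.obj A) : F.act (f - g) x = F.act f x - F.act g x := by
  rw [eq_sub_iff_add_eq, ← add_act, sub_add_cancel]

theorem zero_act (x : F.obj.obj A) : F.act (0 : A ⟶ B) x = 0 := by
  simpa only [sub_self] using sub_act (0 : A ⟶ B) 0 x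

theorem component_act (w : F ⟶ G) (f : A ⟶ B) (x : F.obj.obj A) :
    component w B (F.act f x) = G.act f (component w A x) :=
  congr($(w.hom.naturality f).hom x)

theorem component_comp (w : F ⟶ G) (w' : G ⟶ H) (x : F.obj.obj A) :
    component (w ≫ w') A x = component w' A (component w A x) :=
  rfl

theorem hom_ext_component {w w' : F ⟶ G} (h : ∀ A x, component w A x = component w' A x) :
    w = w' := by
  ext A x
  exact h A x

/-- The morphism of functors with given components. -/
def mkHom (φ : ∀ A, F.obj.obj A →+ G.obj.obj A)
    (h : ∀ {A B : ModuleCat.{u} R} (f : A ⟶ B) (x : F.obj.obj A),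
      φ B (F.act f x) = G.act f (φ A x)) : F ⟶ G :=
  ObjectProperty.homMk
    { app A := AddCommGrpCat.ofHom (φ A)
      naturality _ _ f := AddCommGrpCat.hom_ext <| AddMonoidHom.ext (h f) }

theorem isIso_of_bijective (w : F ⟶ G) (h : ∀ A, Function.Bijective (component w A)) :
    IsIso w := by
  have : IsIso ((additiveFunctor _ _).ι.map w) :=
    (NatTrans.isIso_iff_isIso_app _).2 fun A => (ConcreteCategory.isIso_iff_bijective _).2 (h A)
  exact isIso_of_reflects_iso w (additiveFunctor _ _).ι

theorem epi_of_surjective (w : F ⟶ G) (h : ∀ A, Function.Surjective (component w A)) : Epi w where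
  left_cancellation _ _ e := hom_ext_component fun A y => by
    obtain ⟨x, rfl⟩ := h A y
    exact congr(component $e A x)

end Elements

section Exactness

/-- Evaluation `F ↦ F(A)`. It is exact, so that exactness of sequences of functors can be checked
on elements. -/
abbrev eval (A : ModuleCat.{u} R) : RFun.{v} R ⥤ AddCommGrpCat.{v} :=
  (additiveFunctor _ _).ι ⋙ (evaluation _ _).obj A

variable {F G : RFun.{v} R}

theorem surjective_of_epi (w : F ⟶ G) [Epi w] (A : ModuleCat.{u} R) :
    Function.Surjective (component w A) :=
  (AddCommGrpCat.epi_iff_surjective ((eval A).map w)).1 inferInstance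

theorem injective_of_mono (w : F ⟶ G) [Mono w] (A : ModuleCat.{u} R) :
    Function.Injective (component w A) :=
  (AddCommGrpCat.mono_iff_injective ((eval A).map w)).1 inferInstance

theorem exact_component {S : ShortComplex (RFun.{v} R)} (hS : S.Exact) (A : ModuleCat.{u} R) :
    Function.Exact (component S.f A) (component S.g A) :=
  (ShortComplex.ab_exact_iff_function_exact _).1 (hS.map (eval A))

end Exactness

section Presentation

variable {D F G T X Y : RFun.{v} R} {A B B' : ModuleCat.{u} R}

/-- `F` is generated by `b ∈ F(B)`, i.e. the morphism `Hom(B, -) → F` given by `b` is an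
epimorphism. -/
def IsGenerator (b : F.obj.obj B) : Prop :=
  ∀ S (x : F.obj.obj S), ∃ f : B ⟶ S, F.act f b = x

/-- The kernel of the morphism `Hom(B, -) → F` given by `b ∈ F(B)` is generated by `g : B → B'`. -/
def IsRelator (b : F.obj.obj B) (g : B ⟶ B') : Prop :=
  ∀ S (f : B ⟶ S), F.act f b = 0 ↔ ∃ h : B' ⟶ S, g ≫ h = f

/-- The sequence `Hom(B', -) → Hom(B, -) → F → 0` given by `g : B → B'` and `b ∈ F(B)` is exact. -/
structure IsPresentation (b : F.obj.obj B) (g : B ⟶ B') : Prop where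
  isGenerator : IsGenerator b
  isRelator : IsRelator b g

/-- `F` is the cokernel of a morphism between representable functors. -/
def IsPresented (F : RFun.{v} R) : Prop :=
  ∃ (B B' : ModuleCat.{u} R) (b : F.obj.obj B) (g : B ⟶ B'), IsPresentation b g

theorem IsGenerator.hom_ext {b : F.obj.obj B} (hb : IsGenerator b) {w w' : F ⟶ T}
    (h : component w B b = component w' B b) : w = w' :=
  hom_ext_component fun S x => by
    obtain ⟨f, rfl⟩ := hb S x
    rw [component_act, component_act, h]

theorem IsRelator.act_eq_zero {b : F.obj.obj B} {g : B ⟶ B'} (hg : IsRelator b g) :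
    F.act g b = 0 :=
  (hg B' g).2 ⟨𝟙 B', Category.comp_id g⟩

theorem IsGenerator.exists_hom {b : F.obj.obj B} (hb : IsGenerator b) (t : T.obj.obj B)
    (ht : ∀ S (f : B ⟶ S), F.act f b = 0 → T.act f t = 0) :
    ∃ w : F ⟶ T, component w B b = t := by
  choose f hf using hb
  have act_eq (S) (x : F.obj.obj S) (k : B ⟶ S) (hk : F.act k b = x) :
      T.act (f S x) t = T.act k t := by
    rw [← sub_eq_zero, ← sub_act]
    exact ht _ _ (by rw [sub_act, hf, hk, sub_self])
  refine ⟨mkHom (fun S => AddMonoidHom.mk' (fun x => T.act (f S x) t) fun x y => ?_)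
    fun {S S'} k x => ?_, ?_⟩
  · rw [← add_act]
    exact act_eq _ _ _ (by rw [add_act, hf, hf])
  · change T.act (f S' _) t = T.act k (T.act _ t)
    rw [← act_comp]
    exact act_eq _ _ _ (by rw [act_comp, hf])
  · exact (act_eq _ _ (𝟙 B) (act_id b)).trans (act_id t)

theorem IsPresentation.exists_hom_iff {b : F.obj.obj B} {g : B ⟶ B'} (h : IsPresentation b g)
    (t : T.obj.obj B) : (∃ w : F ⟶ T, component w B b = t) ↔ T.act g t = 0 := by
  constructor
  · rintro ⟨w, rfl⟩
    rw [← component_act, h.isRelator.act_eq_zero, map_zero]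
  · refine fun ht => h.isGenerator.exists_hom t fun S f hf => ?_
    obtain ⟨k, rfl⟩ := (h.isRelator S f).1 hf
    rw [act_comp, ht, map_zero]

theorem IsPresented.exists_isRelator (hF : F.IsPresented) (x : F.obj.obj A) :
    ∃ (Q : ModuleCat.{u} R) (q : A ⟶ Q), IsRelator x q := by
  obtain ⟨B, B', b, g, hb, hg⟩ := hF
  obtain ⟨k, rfl⟩ := hb A x
  refine ⟨pushout k g, pushout.inl k g, fun S f => ?_⟩
  rw [← act_comp, hg]
  constructor
  · rintro ⟨h, e⟩
    exact ⟨pushout.desc f h e.symm, pushout.inl_desc _ _ _⟩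
  · rintro ⟨h, rfl⟩
    exact ⟨pushout.inr k g ≫ h, by rw [← pushout.condition_assoc]⟩

theorem IsGenerator.isPresented_of_exact {i : D ⟶ X} {p : X ⟶ Y}
    (hp : ∀ S, Function.Surjective (component p S))
    (hip : ∀ S, Function.Exact (component i S) (component p S))
    {d : D.obj.obj B'} (hd : IsGenerator d) {x : X.obj.obj B} (hx : IsGenerator x)
    (hx₀ : ∀ S (f : B ⟶ S), X.act f x = 0 → f = 0) :
    Y.IsPresented := by
  obtain ⟨g, hg⟩ := hx B' (component i B' d)
  refine ⟨B, B', component p B x, g, fun S y => ?_, fun S f => ?_⟩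
  · obtain ⟨z, rfl⟩ := hp S y
    obtain ⟨f, rfl⟩ := hx S z
    exact ⟨f, (component_act p f x).symm⟩
  · rw [← component_act, hip]
    have act_eq (h : B' ⟶ S) : component i S (D.act h d) = X.act (g ≫ h) x := by
      rw [component_act, act_comp, hg]
    constructor
    · rintro ⟨e, he⟩
      obtain ⟨h, rfl⟩ := hd S e
      refine ⟨h, sub_eq_zero.1 (hx₀ S _ ?_)⟩
      rw [sub_act, ← act_eq, he, sub_self]
    · rintro ⟨h, rfl⟩
      exact ⟨D.act h d, act_eq h⟩

end Presentation

section RightExact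

variable {D T X Y : RFun.{v} R} {A B C : ModuleCat.{u} R}

theorem preservesFiniteColimits_of_exact
    (hT : ∀ {A B C : ModuleCat.{u} R} (f : A ⟶ B) (g : B ⟶ C), Function.Surjective g →
      Function.Exact f g → Function.Surjective (T.act g) ∧ Function.Exact (T.act f) (T.act g)) :
    PreservesFiniteColimits T.obj := by
  refine ((Functor.preservesFiniteColimits_tfae T.obj).out 0 3).1 fun S hS => ?_
  obtain ⟨hg, hfg⟩ := hT S.f S.g ((ModuleCat.epi_iff_surjective _).1 hS.epi_g)
    ((ShortComplex.ShortExact.moduleCat_exact_iff_function_exact _).1 hS.exact)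
  exact ⟨(ShortComplex.ab_exact_iff_function_exact _).2 hfg,
    (AddCommGrpCat.epi_iff_surjective _).2 hg⟩

theorem exact_act [PreservesFiniteColimits T.obj] (f : A ⟶ B) (g : B ⟶ C)
    (hg : Function.Surjective g) (hfg : Function.Exact f g) :
    Function.Exact (T.act f) (T.act g) := by
  let S := ShortComplex.mk f g (by ext x; exact hfg.apply_apply_eq_zero x)
  have : Epi S.g := (ModuleCat.epi_iff_surjective g).2 hg
  have hS : S.Exact := (ShortComplex.ShortExact.moduleCat_exact_iff_function_exact S).2 hfg
  exact (ShortComplex.ab_exact_iff_function_exact _).1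
    (hS.map_of_epi_of_preservesCokernel T.obj ‹_› inferInstance)

theorem exists_act_eq [PreservesFiniteColimits T.obj] (q : A ⟶ B) (t : T.obj.obj B)
    (ht : T.act (cokernel.π q) t = 0) : ∃ t', T.act q t' = t :=
  (exact_act q (cokernel.π q) ((ModuleCat.epi_iff_surjective _).1 inferInstance)
    ((ShortComplex.ShortExact.moduleCat_exact_iff_function_exact _).1
      (ShortComplex.exact_cokernel q)) t).1 ht

/-- If `q` is a relator of `p x`, then `q x` comes from some `d₀` in `D`, and an extension of `η`
amounts to a `t ∈ T(A)` with `q t = η d₀`; such a `t` exists because `T` is right exact. -/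
theorem exists_extension [PreservesFiniteColimits T.obj] {i : D ⟶ X} {p : X ⟶ Y}
    (hip : ∀ S, Function.Exact (component i S) (component p S)) {x : X.obj.obj A}
    (hx : IsGenerator x) (hY : Y.IsPresented) (η : D ⟶ T)
    (hη : ∀ S d, component i S d = 0 → component η S d = 0) : ∃ ε : X ⟶ T, i ≫ ε = η := by
  obtain ⟨Q, q, hq⟩ := hY.exists_isRelator (component p A x)
  obtain ⟨d₀, hd₀⟩ := (hip Q (X.act q x)).1 (by rw [component_act, hq.act_eq_zero])
  obtain ⟨t, ht⟩ := exists_act_eq (T := T) q (component η Q d₀) (by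
    rw [← component_act]
    refine hη _ _ ?_
    rw [component_act, hd₀, ← act_comp, cokernel.condition, zero_act])
  have η_eq (S) (f : A ⟶ S) (d) (hd : component i S d = X.act f x) :
      component η S d = T.act f t := by
    have hf : Y.act f (component p A x) = 0 := by
      rw [← component_act, ← hd, (hip S).apply_apply_eq_zero]
    obtain ⟨h, rfl⟩ := (hq S f).1 hf
    rw [act_comp, ht, ← component_act, ← sub_eq_zero, ← map_sub]
    refine hη _ _ ?_
    rw [map_sub, component_act, hd, hd₀, act_comp, sub_self]
  obtain ⟨ε, hε⟩ := hx.exists_hom t fun S f hf => by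
    rw [← η_eq S f 0 (by rw [hf, map_zero]), map_zero]
  refine ⟨ε, hom_ext_component fun S d => ?_⟩
  obtain ⟨f, hf⟩ := hx S (component i S d)
  rw [component_comp, η_eq S f d hf.symm, ← hε, ← component_act, hf]

end RightExact

section Ext

universe w

theorem subsingleton_ext_one_of_exists_extension {𝒜 : Type*} [Category* 𝒜] [Abelian 𝒜]
    [HasExt.{w} 𝒜] {S : ShortComplex 𝒜} (hS : S.ShortExact) [Projective S.X₂] (T : 𝒜)
    (hT : ∀ η : S.X₁ ⟶ T, ∃ ε : S.X₂ ⟶ T, S.f ≫ ε = η) :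
    Subsingleton (Abelian.Ext S.X₃ T 1) := by
  refine subsingleton_of_forall_eq 0 fun y => ?_
  obtain ⟨x, rfl⟩ := Abelian.Ext.contravariant_sequence_exact₃ hS T y
    (Abelian.Ext.eq_zero_of_projective _) (n₀ := 0) rfl
  obtain ⟨η, rfl⟩ := (Abelian.Ext.mk₀_bijective _ _).2 x
  obtain ⟨ε, rfl⟩ := hT η
  rw [← Abelian.Ext.mk₀_comp_mk₀]
  exact hS.extClass_comp_assoc _

theorem subsingleton_ext_succ_of_projective {𝒜 : Type*} [Category* 𝒜] [Abelian 𝒜] [HasExt.{w} 𝒜]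
    {S : ShortComplex 𝒜} (hS : S.ShortExact) [Projective S.X₂] (T : 𝒜) (n : ℕ)
    [Subsingleton (Abelian.Ext S.X₁ T n)] : Subsingleton (Abelian.Ext S.X₃ T (n + 1)) := by
  refine subsingleton_of_forall_eq 0 fun y => ?_
  obtain ⟨x, rfl⟩ := Abelian.Ext.contravariant_sequence_exact₃ hS T y
    (Abelian.Ext.eq_zero_of_projective _) (n₀ := n) (Nat.add_comm 1 n)
  rw [Subsingleton.elim x 0, Abelian.Ext.comp_zero]

variable {F T : RFun.{u} R} {B B' : ModuleCat.{u} R}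

/-- The representable functor `Hom(B, -)`. -/
def representable (B : ModuleCat.{u} R) : RFun.{u} R := AdditiveFunctor.of (homFrom B)

/-- The morphism `Hom(B, -) → F` given by an element of `F(B)`. -/
def reprHom (b : F.obj.obj B) : representable B ⟶ F :=
  mkHom (fun _ => AddMonoidHom.mk' (fun f : B ⟶ _ => F.act f b) fun _ _ => add_act _ _ _)
    fun _ _ => act_comp _ _ _

theorem component_reprHom (b : F.obj.obj B) {S : ModuleCat.{u} R} (f : B ⟶ S) :
    component (reprHom b) S f = F.act f b :=
  rfl

theorem isGenerator_id (B : ModuleCat.{u} R) : IsGenerator (F := representable B) (𝟙 B) :=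
  fun _ f => ⟨f, Category.id_comp f⟩

theorem reprHom_comp {G : RFun.{u} R} (b : F.obj.obj B) (w : F ⟶ G) :
    reprHom b ≫ w = reprHom (component w B b) :=
  hom_ext_component fun _ _ => component_act w _ b

theorem exists_eq_reprHom (w : representable B ⟶ F) : ∃ b, w = reprHom b :=
  ⟨component w B (𝟙 B), (isGenerator_id B).hom_ext (act_id _).symm⟩

instance (B : ModuleCat.{u} R) : Projective (representable B) where
  factors {E X} f e _ := by
    obtain ⟨x, rfl⟩ := exists_eq_reprHom f
    obtain ⟨y, rfl⟩ := surjective_of_epi e B x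
    exact ⟨reprHom y, reprHom_comp y e⟩

theorem IsGenerator.shortExact_kernel {b : F.obj.obj B} (hb : IsGenerator b) :
    (ShortComplex.mk _ _ (kernel.condition (reprHom b))).ShortExact :=
  have : Epi (reprHom b) := epi_of_surjective _ hb
  .mk (ShortComplex.exact_kernel _)

theorem exact_kernel_reprHom (b : F.obj.obj B) (S : ModuleCat.{u} R) :
    Function.Exact (component (kernel.ι (reprHom b)) S) (component (reprHom b) S) :=
  exact_component (ShortComplex.exact_kernel _) S

theorem isRelator_iff_isGenerator (b : F.obj.obj B) (κ : (kernel (reprHom b)).obj.obj B') :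
    IsRelator b (component (kernel.ι (reprHom b)) B' κ : B ⟶ B') ↔ IsGenerator κ := by
  have act_κ {S : ModuleCat.{u} R} (h : B' ⟶ S) :
      component (kernel.ι (reprHom b)) S ((kernel (reprHom b)).act h κ) =
        (component (kernel.ι (reprHom b)) B' κ : B ⟶ B') ≫ h := component_act _ h κ
  refine forall_congr' fun S => ⟨fun hg k => ?_, fun hκ f => ?_⟩
  · obtain ⟨h, hh⟩ := (hg _).1 ((exact_kernel_reprHom b S).apply_apply_eq_zero k)
    exact ⟨h, injective_of_mono (kernel.ι (reprHom b)) S ((act_κ h).trans hh)⟩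
  · refine (exact_kernel_reprHom b S f).trans ⟨?_, ?_⟩
    · rintro ⟨k, rfl⟩
      obtain ⟨h, rfl⟩ := hκ k
      exact ⟨h, (act_κ h).symm⟩
    · rintro ⟨h, rfl⟩
      exact ⟨_, act_κ h⟩

theorem IsRelator.isPresented_kernel {b : F.obj.obj B} {g : B ⟶ B'} (hg : IsRelator b g) :
    (kernel (reprHom b)).IsPresented := by
  obtain ⟨κ, rfl⟩ := (exact_kernel_reprHom b B' g).1 hg.act_eq_zero
  refine ⟨B', _, κ, cokernel.π (component (kernel.ι (reprHom b)) B' κ : B ⟶ B'),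
    (isRelator_iff_isGenerator b κ).1 hg, fun S f => ?_⟩
  rw [← map_eq_zero_iff _ (injective_of_mono (kernel.ι (reprHom b)) S), component_act]
  constructor
  · exact fun h => ⟨cokernel.desc _ f h, cokernel.π_desc _ _ _⟩
  · rintro ⟨h, rfl⟩
    exact (cokernel.condition_assoc _ h).trans zero_comp

theorem IsPresented.subsingleton_ext (hF : F.IsPresented) (T : RFun.{u} R)
    [PreservesFiniteColimits T.obj] (n : ℕ) :
    Subsingleton (Abelian.Ext.{u + 1} F T (n + 1)) := by
  induction n generalizing F with
  | zero =>
    obtain ⟨B, B', b, g, h⟩ := id hF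
    refine subsingleton_ext_one_of_exists_extension h.isGenerator.shortExact_kernel T fun η => ?_
    refine exists_extension (exact_kernel_reprHom b) (isGenerator_id B) hF η fun S d hd => ?_
    rw [(map_eq_zero_iff _ (injective_of_mono _ S)).1 hd, map_zero]
  | succ n ih =>
    obtain ⟨B, B', b, g, h⟩ := hF
    have := ih h.isRelator.isPresented_kernel
    exact subsingleton_ext_succ_of_projective h.isGenerator.shortExact_kernel T (n + 1)

end Ext

section DirectedColimits

variable {J : Type u} [Preorder J] [IsDirectedOrder J] [Nonempty J]

theorem nonempty_isColimit_of_elements {K : J ⥤ ModuleCat.{u} R} (c : Cocone K)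
    (hc : ∀ x : c.pt, ∃ j y, c.ι.app j y = x)
    (hc' : ∀ j (y : K.obj j), c.ι.app j y = 0 → ∃ (k : J) (f : j ⟶ k), K.map f y = 0) :
    Nonempty (IsColimit c) := by
  have : ReflectsColimitsOfShape J (forget (ModuleCat.{u} R)) :=
    reflectsColimitsOfShape_of_reflectsIsomorphisms
  refine ⟨isColimitOfReflects (forget _) (Types.FilteredColimit.isColimitOf' _ _ (fun x => ?_)
    fun j y y' h => ?_)⟩
  · obtain ⟨j, y, hy⟩ := hc x
    exact ⟨j, y, hy.symm⟩
  · obtain ⟨k, f, hf⟩ := hc' j (y - y') (by rw [map_sub]; exact sub_eq_zero.2 h)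
    exact ⟨k, f, sub_eq_zero.1 ((map_sub (K.map f).hom y y').symm.trans hf)⟩

variable {F : RFun.{u} R}

theorem PreservesDirectLimits.exists_rep (hF : F.PreservesDirectLimits) {K : J ⥤ ModuleCat.{u} R}
    {c : Cocone K} (hc : IsColimit c) (x : F.obj.obj c.pt) :
    ∃ (j : J) (y : F.obj.obj (K.obj j)), F.act (c.ι.app j) y = x := by
  have := hF J
  exact Concrete.isColimit_exists_rep (K ⋙ F.obj) (isColimitOfPreserves F.obj hc) x

theorem PreservesDirectLimits.exists_act_eq_zero (hF : F.PreservesDirectLimits)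
    {K : J ⥤ ModuleCat.{u} R} {c : Cocone K} (hc : IsColimit c) {j : J} (y : F.obj.obj (K.obj j))
    (hy : F.act (c.ι.app j) y = 0) : ∃ (k : J) (f : j ⟶ k), F.act (K.map f) y = 0 := by
  have := hF J
  obtain ⟨k, f, g, h⟩ := Concrete.isColimit_exists_of_rep_eq (K ⋙ F.obj)
    (isColimitOfPreserves F.obj hc) y 0 (hy.trans (map_zero (F.act (c.ι.app j))).symm)
  exact ⟨k, f, h.trans (map_zero (F.act (K.map g)))⟩

variable (S : ModuleCat.{u} R)

/-- The finitely generated submodules of `S`. -/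
def fgDiagram : {N : Submodule R S // N.FG} ⥤ ModuleCat.{u} R where
  obj N := ModuleCat.of R N.1
  map f := ModuleCat.ofHom (Submodule.inclusion f.le)

/-- The cocone with point `S` on the finitely generated submodules of `S`. -/
def fgCocone : Cocone (fgDiagram S) where
  pt := S
  ι := { app N := ModuleCat.ofHom N.1.subtype }

theorem nonempty_isColimit_fgCocone : Nonempty (IsColimit (fgCocone S)) := by
  refine nonempty_isColimit_of_elements _ (fun x => ?_) fun N y hy => ⟨N, 𝟙 N, ?_⟩
  · exact ⟨⟨_, Submodule.fg_span_singleton x⟩, ⟨x, Submodule.mem_span_singleton_self x⟩, rfl⟩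
  · exact Subtype.ext hy

variable {S} (N : Submodule R S)

instance : IsDirectedOrder {P : Submodule R S // P.FG ∧ P ≤ N} where
  directed P Q := ⟨⟨P.1 ⊔ Q.1, P.2.1.sup Q.2.1, sup_le P.2.2 Q.2.2⟩,
    le_sup_left (a := P.1), le_sup_right (a := P.1)⟩

instance : Nonempty {P : Submodule R S // P.FG ∧ P ≤ N} := ⟨⟨⊥, Submodule.fg_bot, bot_le⟩⟩

/-- The quotients of `S` by finitely generated submodules of `N`. -/
def fgQuotDiagram : {P : Submodule R S // P.FG ∧ P ≤ N} ⥤ ModuleCat.{u} R where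
  obj P := ModuleCat.of R (S ⧸ P.1)
  map f := ModuleCat.ofHom (Submodule.factor f.le)
  map_id _ := ModuleCat.hom_ext (Submodule.linearMap_qext _ rfl)
  map_comp _ _ := ModuleCat.hom_ext (Submodule.linearMap_qext _ rfl)

/-- For `q : S → M`, the cocone with point `M` on the quotients of `S` by finitely generated
submodules of the kernel of `q`. -/
def fgQuotCocone {M : ModuleCat.{u} R} (q : S ⟶ M) :
    Cocone (fgQuotDiagram (LinearMap.ker q.hom)) where
  pt := M
  ι :=
    { app P := ModuleCat.ofHom (P.1.liftQ q.hom P.2.2)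
      naturality _ _ _ := ModuleCat.hom_ext (Submodule.linearMap_qext _ rfl) }

theorem nonempty_isColimit_fgQuotCocone {M : ModuleCat.{u} R} (q : S ⟶ M)
    (hq : Function.Surjective q) : Nonempty (IsColimit (fgQuotCocone q)) := by
  refine nonempty_isColimit_of_elements _ (fun x => ?_) fun P y hy => ?_
  · obtain ⟨x, rfl⟩ := hq x
    exact ⟨⟨⊥, Submodule.fg_bot, bot_le⟩, Submodule.mkQ _ x, rfl⟩
  · obtain ⟨y, rfl⟩ := Submodule.mkQ_surjective _ y
    have hy : y ∈ LinearMap.ker q.hom := hy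
    refine ⟨⟨P.1 ⊔ R ∙ y, P.2.1.sup (Submodule.fg_span_singleton y),
      sup_le P.2.2 ((Submodule.span_singleton_le_iff_mem y _).2 hy)⟩,
      homOfLE (le_sup_left (a := P.1)), ?_⟩
    exact (Submodule.Quotient.mk_eq_zero _).2
      (le_sup_right (a := P.1) (Submodule.mem_span_singleton_self y))

theorem finitePresentation_quotient {M : Type*} [AddCommGroup M] [Module R M]
    [Module.FinitePresentation R M] {P : Submodule R M} (hP : P.FG) :
    Module.FinitePresentation R (M ⧸ P) :=
  Module.finitePresentation_of_surjective P.mkQ (Submodule.mkQ_surjective _)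
    (by rwa [Submodule.ker_mkQ])

end DirectedColimits

section FinitelyPresented

variable {F : RFun.{u} R}

theorem PreservesDirectLimits.exists_finite (hF : F.PreservesDirectLimits)
    {S : ModuleCat.{u} R} (x : F.obj.obj S) :
    ∃ (N : ModuleCat.{u} R) (h : N ⟶ S) (y : F.obj.obj N), Module.Finite R N ∧ F.act h y = x := by
  obtain ⟨hc⟩ := nonempty_isColimit_fgCocone S
  obtain ⟨N, y, hy⟩ := hF.exists_rep hc x
  exact ⟨_, _, y, Module.Finite.iff_fg.2 N.2, hy⟩

theorem PreservesDirectLimits.exists_factorization_finite (hF : F.PreservesDirectLimits)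
    {B S : ModuleCat.{u} R} [Module.Finite R B] (b : F.obj.obj B) (h : B ⟶ S)
    (hb : F.act h b = 0) :
    ∃ (N : ModuleCat.{u} R) (k : B ⟶ N) (l : N ⟶ S),
      Module.Finite R N ∧ h = k ≫ l ∧ F.act k b = 0 := by
  obtain ⟨hc⟩ := nonempty_isColimit_fgCocone S
  let N₀ : {N : Submodule R S // N.FG} := ⟨LinearMap.range h.hom, Submodule.FG.of_finite⟩
  let h₀ : B ⟶ (fgDiagram S).obj N₀ := ModuleCat.ofHom h.hom.rangeRestrict
  obtain ⟨N, f, hf⟩ := hF.exists_act_eq_zero hc (F.act h₀ b) (by rw [← act_comp]; exact hb)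
  exact ⟨_, h₀ ≫ (fgDiagram S).map f, (fgCocone S).ι.app N, Module.Finite.iff_fg.2 N.2, rfl,
    by rw [act_comp, hf]⟩

theorem PreservesDirectLimits.exists_finitePresentation_quotient (hF : F.PreservesDirectLimits)
    {M S : ModuleCat.{u} R} [Module.FinitePresentation R M] (q : M ⟶ S)
    (hq : Function.Surjective q) (x : F.obj.obj S) :
    ∃ (A : ModuleCat.{u} R) (h : A ⟶ S) (y : F.obj.obj A),
      Module.FinitePresentation R A ∧ F.act h y = x := by
  obtain ⟨hc⟩ := nonempty_isColimit_fgQuotCocone q hq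
  obtain ⟨P, z, hz⟩ := hF.exists_rep hc x
  exact ⟨_, _, z, finitePresentation_quotient P.2.1, hz⟩

theorem PreservesDirectLimits.exists_factorization_quotient (hF : F.PreservesDirectLimits)
    {M S : ModuleCat.{u} R} [Module.FinitePresentation R M] (q : M ⟶ S)
    (hq : Function.Surjective q) (y : F.obj.obj M) (hy : F.act q y = 0) :
    ∃ (A : ModuleCat.{u} R) (k : M ⟶ A) (l : A ⟶ S),
      Module.FinitePresentation R A ∧ q = k ≫ l ∧ F.act k y = 0 := by
  obtain ⟨hc⟩ := nonempty_isColimit_fgQuotCocone q hq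
  let P₀ : {P : Submodule R M // P.FG ∧ P ≤ LinearMap.ker q.hom} := ⟨⊥, Submodule.fg_bot, bot_le⟩
  let i : M ⟶ (fgQuotDiagram (LinearMap.ker q.hom)).obj P₀ := ModuleCat.ofHom (Submodule.mkQ _)
  obtain ⟨P, g, hg⟩ := hF.exists_act_eq_zero hc (F.act i y) (by rw [← act_comp]; exact hy)
  exact ⟨_, i ≫ (fgQuotDiagram _).map g, (fgQuotCocone q).ι.app P,
    finitePresentation_quotient P.2.1, rfl, by rw [act_comp, hg]⟩

theorem PreservesDirectLimits.exists_finitePresentation (hF : F.PreservesDirectLimits)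
    {S : ModuleCat.{u} R} (x : F.obj.obj S) :
    ∃ (A : ModuleCat.{u} R) (h : A ⟶ S) (y : F.obj.obj A),
      Module.FinitePresentation R A ∧ F.act h y = x := by
  obtain ⟨N, h, y, hN, rfl⟩ := hF.exists_finite x
  obtain ⟨n, p, hp⟩ := Module.Finite.exists_fin' R N
  obtain ⟨A, k, z, hA, rfl⟩ := hF.exists_finitePresentation_quotient
    (M := ModuleCat.of R (Fin n → R)) (ModuleCat.ofHom p) hp y
  exact ⟨A, k ≫ h, z, hA, act_comp _ _ _⟩

theorem PreservesDirectLimits.exists_factorization (hF : F.PreservesDirectLimits)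
    {B S : ModuleCat.{u} R} [Module.FinitePresentation R B] (b : F.obj.obj B) (h : B ⟶ S)
    (hb : F.act h b = 0) :
    ∃ (A : ModuleCat.{u} R) (k : B ⟶ A) (l : A ⟶ S),
      Module.FinitePresentation R A ∧ h = k ≫ l ∧ F.act k b = 0 := by
  obtain ⟨N, k, l, hN, rfl, hk⟩ := hF.exists_factorization_finite b h hb
  obtain ⟨n, p, hp⟩ := Module.Finite.exists_fin' R N
  let i : B ⟶ ModuleCat.of R (B × (Fin n → R)) := ModuleCat.ofHom (LinearMap.inl R B (Fin n → R))
  let q : ModuleCat.of R (B × (Fin n → R)) ⟶ N := ModuleCat.ofHom (k.hom.coprod p)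
  have hiq : i ≫ q = k := ModuleCat.hom_ext (LinearMap.coprod_inl _ _)
  obtain ⟨A, k', l', hA, hq, h0⟩ := hF.exists_factorization_quotient q (fun x => by
    obtain ⟨y, rfl⟩ := hp x
    exact ⟨(0, y), congr($(LinearMap.coprod_inr k.hom p) y)⟩) (F.act i b) (by
      rw [← act_comp, hiq, hk])
  refine ⟨A, i ≫ k', l' ≫ l, hA, ?_, by rw [act_comp, h0]⟩
  rw [← hiq, hq]
  simp

theorem PreservesDirectProducts.exists_act_proj_eq (hF : F.PreservesDirectProducts) {I : Type u}
    (A : I → ModuleCat.{u} R) (x : ∀ i, F.obj.obj (A i)) :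
    ∃ y : F.obj.obj (ModuleCat.of R (∀ i, A i)),
      ∀ i, F.act (ModuleCat.ofHom (LinearMap.proj i)) y = x i := by
  have := hF I
  let hl := isLimitOfPreserves (forget AddCommGrpCat)
    (isLimitOfPreserves F.obj (ModuleCat.productConeIsLimit A))
  refine ⟨(Types.isLimitEquivSections hl).symm ⟨fun i => x i.as, ?_⟩, fun i =>
    Types.isLimitEquivSections_symm_apply hl _ ⟨i⟩⟩
  rintro ⟨i⟩ ⟨j⟩ ⟨⟨h⟩⟩
  obtain rfl : i = j := h
  exact act_id (x i)

theorem PreservesDirectProducts.eq_zero_of_act_proj (hF : F.PreservesDirectProducts) {I : Type u}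
    (A : I → ModuleCat.{u} R) (y : F.obj.obj (ModuleCat.of R (∀ i, A i)))
    (hy : ∀ i, F.act (ModuleCat.ofHom (LinearMap.proj i : _ →ₗ[R] A i)) y = 0) : y = 0 := by
  have := hF I
  refine Concrete.isLimit_ext _ (isLimitOfPreserves F.obj (ModuleCat.productConeIsLimit A)) y 0 ?_
  rintro ⟨i⟩
  exact (hy i).trans (map_zero (F.act _)).symm

/-- A small set of codes for the finitely presented modules: `⟨n, N⟩` stands for `Rⁿ / N`. -/
abbrev FPIndex (R : Type u) [Ring R] : Type u := Σ n : ℕ, {N : Submodule R (Fin n → R) // N.FG}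

/-- The finitely presented module `Rⁿ / N` with code `⟨n, N⟩`. -/
abbrev fpModule (j : FPIndex R) : ModuleCat.{u} R := ModuleCat.of R ((Fin j.1 → R) ⧸ j.2.1)

theorem exists_iso_fpModule (A : ModuleCat.{u} R) [Module.FinitePresentation R A] :
    ∃ j : FPIndex R, Nonempty (A ≅ fpModule j) := by
  obtain ⟨n, N, e, hN⟩ := Module.FinitePresentation.exists_fin R A
  exact ⟨⟨n, N, hN⟩, ⟨e.toModuleIso⟩⟩

theorem exists_isGenerator
    (hF : ∀ S (x : F.obj.obj S), ∃ (A : ModuleCat.{u} R) (h : A ⟶ S) (y : F.obj.obj A),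
      Module.FinitePresentation R A ∧ F.act h y = x)
    (hF' : ∀ {I : Type u} (A : I → ModuleCat.{u} R) (x : ∀ i, F.obj.obj (A i)),
      ∃ y : F.obj.obj (ModuleCat.of R (∀ i, A i)),
        ∀ i, F.act (ModuleCat.ofHom (LinearMap.proj i)) y = x i) :
    ∃ (B : ModuleCat.{u} R) (b : F.obj.obj B), Module.FinitePresentation R B ∧ IsGenerator b := by
  obtain ⟨y, hy⟩ := hF' (fun i : Σ j : FPIndex R, F.obj.obj (fpModule j) => fpModule i.1)
    fun i => i.2
  obtain ⟨B, h, b, hB, rfl⟩ := hF _ y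
  refine ⟨B, b, hB, fun S x => ?_⟩
  obtain ⟨A, k, a, hA, rfl⟩ := hF S x
  obtain ⟨j, ⟨e⟩⟩ := exists_iso_fpModule A
  refine ⟨h ≫ ModuleCat.ofHom (LinearMap.proj
    (⟨j, F.act e.hom a⟩ : Σ j : FPIndex R, F.obj.obj (fpModule j))) ≫ e.inv ≫ k, ?_⟩
  rw [act_comp, act_comp, act_comp]
  refine congrArg (F.act k) ((congrArg (F.act e.inv) (hy ⟨j, F.act e.hom a⟩)).trans ?_)
  rw [← act_comp, e.hom_inv_id, act_id]

theorem PreservesDirectLimits.exists_finitePresentation_kernel (hF : F.PreservesDirectLimits)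
    {B S : ModuleCat.{u} R} [Module.FinitePresentation R B] (b : F.obj.obj B)
    (x : (kernel (reprHom b)).obj.obj S) :
    ∃ (A : ModuleCat.{u} R) (h : A ⟶ S) (y : (kernel (reprHom b)).obj.obj A),
      Module.FinitePresentation R A ∧ (kernel (reprHom b)).act h y = x := by
  obtain ⟨A, k, l, hA, hkl, hk⟩ := hF.exists_factorization b
    (component (kernel.ι (reprHom b)) S x) ((exact_kernel_reprHom b S).apply_apply_eq_zero x)
  obtain ⟨y, rfl⟩ := (exact_kernel_reprHom b A k).1 hk
  exact ⟨A, l, y, hA, injective_of_mono (kernel.ι (reprHom b)) S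
    ((component_act _ l y).trans hkl.symm)⟩

theorem PreservesDirectProducts.exists_act_proj_eq_kernel (hF : F.PreservesDirectProducts)
    {B : ModuleCat.{u} R} (b : F.obj.obj B) {I : Type u} (A : I → ModuleCat.{u} R)
    (x : ∀ i, (kernel (reprHom b)).obj.obj (A i)) :
    ∃ y : (kernel (reprHom b)).obj.obj (ModuleCat.of R (∀ i, A i)),
      ∀ i, (kernel (reprHom b)).act (ModuleCat.ofHom (LinearMap.proj i)) y = x i := by
  let f (i : I) : B ⟶ A i := component (kernel.ι (reprHom b)) (A i) (x i)
  let π : B ⟶ ModuleCat.of R (∀ i, A i) := ModuleCat.ofHom (LinearMap.pi fun i => (f i).hom)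
  obtain ⟨y, hy⟩ := (exact_kernel_reprHom b _ π).1 <| hF.eq_zero_of_act_proj A _ fun i => by
    rw [component_reprHom, ← act_comp]
    exact (exact_kernel_reprHom b (A i)).apply_apply_eq_zero (x i)
  refine ⟨y, fun i => injective_of_mono (kernel.ι (reprHom b)) _ ?_⟩
  rw [component_act, hy]
  rfl

theorem IsFP.exists_isRelator (hF : F.IsFP) {B : ModuleCat.{u} R} [Module.FinitePresentation R B]
    (b : F.obj.obj B) :
    ∃ (B' : ModuleCat.{u} R) (g : B ⟶ B'), Module.FinitePresentation R B' ∧ IsRelator b g := by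
  obtain ⟨B', κ, hB', hκ⟩ := exists_isGenerator
    (fun _ => hF.preservesDirectLimits.exists_finitePresentation_kernel b)
    (hF.preservesDirectProducts.exists_act_proj_eq_kernel b)
  exact ⟨B', _, hB', (isRelator_iff_isGenerator b κ).2 hκ⟩

theorem IsFP.exists_isPresentation (hF : F.IsFP) :
    ∃ (B B' : ModuleCat.{u} R) (b : F.obj.obj B) (g : B ⟶ B'), Module.FinitePresentation R B ∧
      Module.FinitePresentation R B' ∧ IsPresentation b g := by
  obtain ⟨B, b, hB, hb⟩ := exists_isGenerator
    (fun _ => hF.preservesDirectLimits.exists_finitePresentation)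
    hF.preservesDirectProducts.exists_act_proj_eq
  obtain ⟨B', g, hB', hg⟩ := hF.exists_isRelator b
  exact ⟨B, B', b, g, hB, hB', hb, hg⟩

end FinitelyPresented

section Tensor

theorem exact_quotientMap {A B C : Type*} [AddCommGroup A] [AddCommGroup B] [AddCommGroup C]
    {H : AddSubgroup A} {K : AddSubgroup B} {L : AddSubgroup C} {f : A →+ B} {g : B →+ C}
    (hfg : Function.Exact f g) (hf : H ≤ K.comap f) (hg : K ≤ L.comap g) (hL : L ≤ K.map g) :
    Function.Exact (QuotientAddGroup.map H K f hf) (QuotientAddGroup.map K L g hg) := by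
  intro y
  induction y using QuotientAddGroup.induction_on with | H y => ?_
  constructor
  · intro hy
    obtain ⟨k, hk, hky⟩ := hL ((QuotientAddGroup.eq_zero_iff (g y)).1 hy)
    obtain ⟨x, hx⟩ := (hfg (y - k)).1 (by rw [map_sub, hky, sub_self])
    refine ⟨x, QuotientAddGroup.eq_iff_sub_mem.2 ?_⟩
    rw [hx, sub_sub_cancel_left]
    exact neg_mem hk
  · rintro ⟨x, hx⟩
    induction x using QuotientAddGroup.induction_on with | H x => ?_
    rw [← hx, QuotientAddGroup.map_mk, QuotientAddGroup.map_mk, hfg.apply_apply_eq_zero,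
      QuotientAddGroup.mk_zero]

variable {M N : ModuleCat.{u} Rᵐᵒᵖ} {A B C S : ModuleCat.{u} R}

theorem smul_tmk (r : R) (m : M) (s : S) : tmk (MulOpposite.op r • m) s = tmk m (r • s) := by
  rw [← sub_eq_zero]
  exact (QuotientAddGroup.eq_zero_iff _).2 (AddSubgroup.subset_closure ⟨m, r, s, rfl⟩)

/-- The additive map `m ↦ m ⊗ s`. -/
def tmkLeft (M : ModuleCat.{u} Rᵐᵒᵖ) (s : S) : M →+ Tens M S :=
  AddMonoidHom.mk' (fun m => tmk m s) fun m m' => add_tmk m m' s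

/-- The additive map `s ↦ m ⊗ s`. -/
def tmkRight (S : ModuleCat.{u} R) (m : M) : S →+ Tens M S :=
  AddMonoidHom.mk' (fun s => tmk m s) fun s t => tmk_add m s t

/-- The additive map on `M ⊗_R S` given by a balanced biadditive map. -/
def Tens.lift {P : Type*} [AddCommGroup P] (φ : M →+ S →+ P)
    (h : ∀ m (r : R) s, φ (MulOpposite.op r • m) s = φ m (r • s)) : Tens M S →+ P :=
  QuotientAddGroup.lift _ (TensorProduct.liftAddHom (R := ℤ) φ (by simp)) (by
    rw [balancedRel, AddSubgroup.closure_le]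
    rintro _ ⟨m, r, s, rfl⟩
    exact (map_sub _ _ _).trans (sub_eq_zero.2 (h m r s)))

theorem surjective_tmap {M' : ModuleCat.{u} Rᵐᵒᵖ} {f : M ⟶ M'} {g : B ⟶ C}
    (hf : Function.Surjective f) (hg : Function.Surjective g) :
    Function.Surjective (tmap f g) := by
  intro t
  obtain ⟨t, rfl⟩ := QuotientAddGroup.mk_surjective t
  obtain ⟨t, rfl⟩ := TensorProduct.map_surjective
    (g := f.hom.toAddMonoidHom.toIntLinearMap) (g' := g.hom.toAddMonoidHom.toIntLinearMap) hf hg t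
  exact ⟨QuotientAddGroup.mk t, rfl⟩

theorem balancedRel_le_map {M' : ModuleCat.{u} Rᵐᵒᵖ} {f : M ⟶ M'} {g : B ⟶ C}
    (hf : Function.Surjective f) (hg : Function.Surjective g) :
    balancedRel M' C ≤ (balancedRel M B).map (TensorProduct.map
      f.hom.toAddMonoidHom.toIntLinearMap g.hom.toAddMonoidHom.toIntLinearMap).toAddMonoidHom := by
  rw [balancedRel, AddSubgroup.closure_le]
  rintro _ ⟨m, r, s, rfl⟩
  obtain ⟨m, rfl⟩ := hf m
  obtain ⟨s, rfl⟩ := hg s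
  exact ⟨_, AddSubgroup.subset_closure ⟨m, r, s, rfl⟩, by simp⟩

theorem exact_tmap {L M N : ModuleCat.{u} Rᵐᵒᵖ} {f : L ⟶ M} {g : M ⟶ N} {f' : A ⟶ B} {g' : B ⟶ C}
    (hg : Function.Surjective g) (hg' : Function.Surjective g')
    (h : Function.Exact
      (TensorProduct.map f.hom.toAddMonoidHom.toIntLinearMap
        f'.hom.toAddMonoidHom.toIntLinearMap)
      (TensorProduct.map g.hom.toAddMonoidHom.toIntLinearMap
        g'.hom.toAddMonoidHom.toIntLinearMap)) :
    Function.Exact (tmap f f') (tmap g g') :=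
  exact_quotientMap h _ _ (balancedRel_le_map hg hg')

theorem exact_tmap_id_left {f : A ⟶ B} {g : B ⟶ C} (hg : Function.Surjective g)
    (hfg : Function.Exact f g) : Function.Exact (tmap (𝟙 M) f) (tmap (𝟙 M) g) :=
  exact_tmap Function.surjective_id hg
    (lTensor_exact M (f := f.hom.toAddMonoidHom.toIntLinearMap)
      (g := g.hom.toAddMonoidHom.toIntLinearMap) hfg hg)

theorem exact_tmap_id_right {L M N : ModuleCat.{u} Rᵐᵒᵖ} {f : L ⟶ M} {g : M ⟶ N}
    (hg : Function.Surjective g) (hfg : Function.Exact f g) :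
    Function.Exact (tmap f (𝟙 S)) (tmap g (𝟙 S)) :=
  exact_tmap hg Function.surjective_id
    (rTensor_exact S (f := f.hom.toAddMonoidHom.toIntLinearMap)
      (g := g.hom.toAddMonoidHom.toIntLinearMap) hfg hg)

instance (M : ModuleCat.{u} Rᵐᵒᵖ) : PreservesFiniteColimits ((quasiCoherent R).obj M).obj :=
  preservesFiniteColimits_of_exact fun _ _ hg hfg =>
    ⟨surjective_tmap Function.surjective_id hg, exact_tmap_id_left hg hfg⟩

instance (S : ModuleCat.{u} R) : PreservesFiniteColimits ((quasiCoherentRight R).obj S).obj :=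
  preservesFiniteColimits_of_exact fun _ _ hg hfg =>
    ⟨surjective_tmap hg Function.surjective_id, exact_tmap_id_right hg hfg⟩

end Tensor

section Hom

variable {N : ModuleCat.{u} Rᵐᵒᵖ} {B S : ModuleCat.{u} R}

/-- The ring `R`, as a right module over itself. -/
abbrev unitModule (R : Type u) [Ring R] : ModuleCat.{u} Rᵐᵒᵖ := ModuleCat.of Rᵐᵒᵖ Rᵐᵒᵖ

/-- The morphism `R → N` of right modules with value `n` at `1`. -/
abbrev fromUnit (n : N) : unitModule R ⟶ N :=
  ModuleCat.ofHom (LinearMap.toSpanSingleton Rᵐᵒᵖ N n)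

/-- The isomorphism `R ⊗_R S → S`. -/
def unitTens (S : ModuleCat.{u} R) : Tens (unitModule R) S ≃+ S :=
  AddMonoidHom.toAddEquiv
    (Tens.lift (AddMonoidHom.mk' (fun x : Rᵐᵒᵖ => DistribSMul.toAddMonoidHom S x.unop)
      fun x y => AddMonoidHom.ext fun s => add_smul x.unop y.unop s)
      fun x r s => mul_smul x.unop r s)
    (tmkRight S (1 : Rᵐᵒᵖ))
    (Tens.hom_ext fun (x : Rᵐᵒᵖ) s => (smul_tmk (M := unitModule R) x.unop (1 : Rᵐᵒᵖ) s).symm.trans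
      (congrArg (tmk (M := unitModule R) · s) (mul_one x)))
    (AddMonoidHom.ext (one_smul R))

theorem tmap_fromUnit (n : N) (t : Tens (unitModule R) S) :
    tmap (fromUnit n) (𝟙 S) t = tmk n (unitTens S t) := by
  obtain ⟨s, rfl⟩ := (unitTens S).symm.surjective t
  rw [AddEquiv.apply_symm_apply]
  exact congr(tmk $(one_smul Rᵐᵒᵖ n) s)

theorem component_tmk (w : (quasiCoherentRight R).obj B ⟶ (quasiCoherentRight R).obj S) (n : N)
    (b : B) : component w N (tmk n b : Tens N B) =
      (tmk n (unitTens S (component w (unitModule R) ((unitTens B).symm b))) : Tens N S) := by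
  have tmk_eq : tmk n b = tmap (fromUnit n) (𝟙 B) ((unitTens B).symm b) := by
    rw [tmap_fromUnit, AddEquiv.apply_symm_apply]
  exact (congrArg (component w N) tmk_eq).trans
    ((component_act w (fromUnit n) ((unitTens B).symm b)).trans (tmap_fromUnit n _))

instance : (quasiCoherentRight R).Full where
  map_surjective {B S} w := by
    let φ : B →+ S := (unitTens S).toAddMonoidHom.comp
      ((component w (unitModule R)).comp (unitTens B).symm.toAddMonoidHom)
    have map_smul (r : R) (b : B) : φ (r • b) = r • φ b := by
      have symm_smul : (unitTens B).symm (r • b) = tmk (MulOpposite.op r : Rᵐᵒᵖ) b :=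
        (unitTens B).symm_apply_eq.2 rfl
      exact congrArg (unitTens S) ((congrArg (component w (unitModule R)) symm_smul).trans
        (component_tmk w (N := unitModule R) (MulOpposite.op r) b))
    refine ⟨ModuleCat.ofHom { φ with map_smul' := map_smul }, hom_ext_component fun N => ?_⟩
    exact DFunLike.congr_fun (Tens.hom_ext fun n b => (component_tmk w n b).symm)

instance : (quasiCoherentRight R).Faithful where
  map_injective {B S f g} h := by
    ext b
    have := congr(unitTens S (component $h (unitModule R) ((unitTens B).symm b)))
    exact (one_smul R (f b)).symm.trans (this.trans (one_smul R (g b)))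

instance : (lift (R := R)).Full where
  map_surjective w := ⟨mkHom
    (fun A => AddMonoidHom.mk' (fun x => (component w A (ULift.up x)).down) fun x y =>
      congrArg ULift.down (map_add (component w A) (ULift.up x) (ULift.up y)))
    fun f x => congrArg ULift.down (component_act w f (ULift.up x)), rfl⟩

end Hom

section Free

variable {N N' : ModuleCat.{u} Rᵐᵒᵖ} {ι : Type} [Fintype ι] [DecidableEq ι]

/-- The isomorphism `N ⊗_R R^ι → N^ι`. -/
def tensFree (N : ModuleCat.{u} Rᵐᵒᵖ) (ι : Type) [Fintype ι] [DecidableEq ι] :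
    Tens N (ModuleCat.of R (ι → R)) ≃+ (ι → N) :=
  AddMonoidHom.toAddEquiv
    (Tens.lift
      (AddMonoidHom.mk' (fun x => AddMonoidHom.mk' (fun (v : ι → R) i => MulOpposite.op (v i) • x)
          fun v v' => funext fun i => add_smul (MulOpposite.op (v i)) (MulOpposite.op (v' i)) x)
        fun x y => AddMonoidHom.ext fun v => funext fun i =>
          smul_add (MulOpposite.op (v i)) x y)
      fun x r v => funext fun i => (mul_smul (MulOpposite.op (v i)) (MulOpposite.op r) x).symm)
    (∑ i, (tmkLeft N (S := ModuleCat.of R (ι → R)) (Pi.single i 1 : ι → R)).comp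
      (Pi.evalAddMonoidHom _ i))
    (Tens.hom_ext fun x (v : ι → R) => by
      refine (AddMonoidHom.finsetSum_apply _ _ _).trans ?_
      refine .trans (Finset.sum_congr rfl fun i _ => smul_tmk (v i) x _) ?_
      refine (map_sum (tmkRight (ModuleCat.of R (ι → R)) x) _ _).symm.trans ?_
      exact congrArg (tmk (S := ModuleCat.of R (ι → R)) x) (pi_eq_sum_univ' v).symm)
    (AddMonoidHom.ext fun y => by
      rw [AddMonoidHom.comp_apply, AddMonoidHom.finsetSum_apply, map_sum]
      ext j
      rw [Finset.sum_apply]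
      change ∑ i, MulOpposite.op ((Pi.single i 1 : ι → R) j) • y i = y j
      simp [Pi.single_apply, apply_ite MulOpposite.op])

theorem tensFree_symm_apply (y : ι → N) : (tensFree N ι).symm y =
    ∑ i, tmk (S := ModuleCat.of R (ι → R)) (y i) (Pi.single i 1 : ι → R) :=
  AddMonoidHom.finsetSum_apply _ _ _

theorem tmap_tensFree_symm (f : N ⟶ N') (y : ι → N) :
    tmap f (𝟙 (ModuleCat.of R (ι → R))) ((tensFree N ι).symm y) =
      (tensFree N' ι).symm fun i => f (y i) := by
  rw [tensFree_symm_apply, tensFree_symm_apply, map_sum]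
  rfl

/-- The element `∑ eᵢ ⊗ eᵢ` of `R^ι ⊗_R R^ι`, which corresponds to the identity of `R^ι` under
`N ⊗_R R^ι ≃ N^ι ≃ Hom(R^ι, N)`. -/
def universalTens (R : Type u) [Ring R] (ι : Type) [Fintype ι] [DecidableEq ι] :
    ((quasiCoherentRight R).obj (ModuleCat.of R (ι → R))).obj.obj
      (ModuleCat.of Rᵐᵒᵖ (ι → Rᵐᵒᵖ)) :=
  (tensFree (ModuleCat.of Rᵐᵒᵖ (ι → Rᵐᵒᵖ)) ι).symm fun i => (Pi.single i 1 : ι → Rᵐᵒᵖ)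

theorem act_universalTens (f : ModuleCat.of Rᵐᵒᵖ (ι → Rᵐᵒᵖ) ⟶ N) :
    ((quasiCoherentRight R).obj (ModuleCat.of R (ι → R))).act f (universalTens R ι) =
      (tensFree N ι).symm fun i => f (Pi.single i 1 : ι → Rᵐᵒᵖ) :=
  tmap_tensFree_symm f _

theorem isGenerator_universalTens : IsGenerator (universalTens R ι) := fun N t => by
  refine ⟨ModuleCat.ofHom (Fintype.linearCombination Rᵐᵒᵖ (tensFree N ι t)),
    (act_universalTens _).trans ?_⟩
  refine (tensFree N ι).symm_apply_eq.2 (funext fun i => ?_)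
  exact (Fintype.linearCombination_apply_single Rᵐᵒᵖ _ i 1).trans (one_smul _ _)

theorem eq_zero_of_act_universalTens (f : ModuleCat.of Rᵐᵒᵖ (ι → Rᵐᵒᵖ) ⟶ N)
    (hf : ((quasiCoherentRight R).obj (ModuleCat.of R (ι → R))).act f (universalTens R ι) = 0) :
    f = 0 := by
  rw [act_universalTens] at hf
  have hf := (tensFree N ι).symm.map_eq_zero_iff.1 hf
  exact ModuleCat.hom_ext (LinearMap.pi_ext' fun i => LinearMap.ext_ring (congrFun hf i))

theorem isPresented_quasiCoherentRight (B : ModuleCat.{u} R) [Module.FinitePresentation R B] :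
    ((quasiCoherentRight R).obj B).IsPresented := by
  obtain ⟨n, m, p, k, hp, hkp⟩ := Module.FinitePresentation.exists_fin' R B
  exact isGenerator_universalTens.isPresented_of_exact
    (i := (quasiCoherentRight R).map (ModuleCat.ofHom k))
    (p := (quasiCoherentRight R).map (ModuleCat.ofHom p))
    (fun N => surjective_tmap Function.surjective_id hp)
    (fun N => exact_tmap_id_left hp hkp)
    isGenerator_universalTens fun N f => eq_zero_of_act_universalTens f

end Free

section Reflexive

variable {F : RFun.{u} R} {G : RFun.{u + 1} R} {B B' : ModuleCat.{u} R}

theorem IsGenerator.up {b : F.obj.obj B} (hb : IsGenerator b) :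
    IsGenerator (F := lift.obj F) (ULift.up b) := fun S x => by
  obtain ⟨f, hf⟩ := hb S x.down
  exact ⟨f, congrArg ULift.up hf⟩

theorem IsRelator.up {b : F.obj.obj B} {g : B ⟶ B'} (hg : IsRelator b g) :
    IsRelator (F := lift.obj F) (ULift.up b) g := fun S f =>
  ⟨fun h => (hg S f).1 (congrArg ULift.down h), fun h => congrArg ULift.up ((hg S f).2 h)⟩

theorem IsPresentation.up {b : F.obj.obj B} {g : B ⟶ B'} (h : IsPresentation b g) :
    IsPresentation (F := lift.obj F) (ULift.up b) g :=
  ⟨h.isGenerator.up, h.isRelator.up⟩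

theorem IsPresented.lift (hF : F.IsPresented) : (lift.obj F).IsPresented := by
  obtain ⟨B, B', b, g, h⟩ := hF
  exact ⟨B, B', ULift.up b, g, h.up⟩

instance [PreservesFiniteColimits F.obj] : PreservesFiniteColimits (lift.obj F).obj :=
  comp_preservesFiniteColimits F.obj AddCommGrpCat.uliftFunctor

theorem evalAt_act (b : G.obj.obj B) {S : ModuleCat.{u} R} (p : B ⟶ S) :
    evalAt G S (G.act p b) = evalAt G B b ≫ lift.map ((quasiCoherentRight R).map p) :=
  dual_hom_ext fun _ w => component_act w p b

theorem IsGenerator.injective_evalAt {b : G.obj.obj B} (hb : IsGenerator b)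
    (N : ModuleCat.{u} Rᵐᵒᵖ) : Function.Injective (component (evalAt G B b) N) :=
  fun _ _ h => hb.hom_ext h

theorem IsPresentation.exact_evalAt {b : G.obj.obj B} {g : B ⟶ B'} (h : IsPresentation b g)
    (N : ModuleCat.{u} Rᵐᵒᵖ) : Function.Exact (component (evalAt G B b) N)
      (component (lift.map ((quasiCoherentRight R).map g)) N) := fun y =>
  (h.exists_hom_iff (T := lift.obj ((quasiCoherent R).obj N)) y).symm

theorem IsPresentation.surjective_toBidual [Module.FinitePresentation R B]
    [Module.FinitePresentation R B'] {b : G.obj.obj B} {g : B ⟶ B'}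
    (h : IsPresentation b g) (S : ModuleCat.{u} R) :
    Function.Surjective (component G.toBidual S) := by
  intro (η : G.dual ⟶ lift.obj ((quasiCoherentRight R).obj S))
  obtain ⟨_, _, x, _, hx⟩ := isPresented_quasiCoherentRight B
  obtain ⟨ε, hε⟩ := exists_extension h.exact_evalAt hx.isGenerator.up
    (isPresented_quasiCoherentRight B').lift η fun N w hw => by
      rw [(map_eq_zero_iff _ (h.isGenerator.injective_evalAt N)).1 hw, map_zero]
  obtain ⟨p, rfl⟩ := (quasiCoherentRight R ⋙ lift).map_surjective ε
  exact ⟨G.act p b, (evalAt_act b p).trans hε⟩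

theorem IsPresentation.exists_comp_eq_of_evalAt_eq_zero [Module.Finite R B]
    [Module.FinitePresentation R B'] {b : G.obj.obj B} {g : B ⟶ B'} (h : IsPresentation b g)
    {S : ModuleCat.{u} R} (p : B ⟶ S)
    (hp : evalAt G S (G.act p b) = 0) : ∃ p' : B' ⟶ S, g ≫ p' = p := by
  let π : B' ⟶ ModuleCat.of R (B' ⧸ LinearMap.range g.hom) := ModuleCat.ofHom (Submodule.mkQ _)
  have hπ : Function.Surjective π := Submodule.mkQ_surjective _
  have hgπ : Function.Exact g π := LinearMap.exact_iff.2 (Submodule.ker_mkQ _)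
  have : Module.FinitePresentation R (B' ⧸ LinearMap.range g.hom) :=
    finitePresentation_quotient Submodule.FG.of_finite
  obtain ⟨_, _, x, _, hx⟩ := isPresented_quasiCoherentRight B'
  obtain ⟨ε, hε⟩ := exists_extension (i := (quasiCoherentRight R).map g)
    (p := (quasiCoherentRight R).map π) (fun N => exact_tmap_id_left hπ hgπ) hx.isGenerator
    (isPresented_quasiCoherentRight _) ((quasiCoherentRight R).map p) fun N y hy => by
      obtain ⟨w, hw⟩ := (h.exact_evalAt N (ULift.up y)).1 (congrArg ULift.up hy)
      have hpw := congr(component $((evalAt_act b p).symm.trans hp) N w)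
      rw [component_comp, hw] at hpw
      exact congrArg ULift.down hpw
  obtain ⟨p', rfl⟩ := (quasiCoherentRight R).map_surjective ε
  exact ⟨p', (quasiCoherentRight R).map_injective (((quasiCoherentRight R).map_comp g p').trans hε)⟩

theorem IsPresentation.injective_toBidual [Module.Finite R B] [Module.FinitePresentation R B']
    {b : G.obj.obj B} {g : B ⟶ B'} (h : IsPresentation b g) (S : ModuleCat.{u} R) :
    Function.Injective (component G.toBidual S) := by
  refine (injective_iff_map_eq_zero _).2 fun x hx => ?_
  obtain ⟨p, rfl⟩ := h.isGenerator S x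
  exact (h.isRelator S p).2 (h.exists_comp_eq_of_evalAt_eq_zero p hx)

theorem IsPresentation.isReflexive [Module.FinitePresentation R B]
    [Module.FinitePresentation R B'] {b : G.obj.obj B} {g : B ⟶ B'} (h : IsPresentation b g) :
    G.IsReflexive :=
  isIso_of_bijective _ fun S => ⟨h.injective_toBidual S, h.surjective_toBidual S⟩

end Reflexive

end RFun

theorem mainTheorem8_general (R : Type u) [Ring R] (F : RFun.{u} R) (hF : F.IsFP) :
    (RFun.lift.obj F).IsReflexive ∧
      ∀ (T : RFun.{u} R) [PreservesFiniteColimits T.obj] (i : ℕ), 0 < i →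
        Subsingleton (Abelian.Ext.{u + 1} F T i) := by
  obtain ⟨B, B', b, g, _, _, h⟩ := hF.exists_isPresentation
  refine ⟨h.up.isReflexive, fun T _ i hi => ?_⟩
  obtain ⟨n, rfl⟩ := Nat.exists_eq_succ_of_ne_zero hi.ne'
  exact RFun.IsPresented.subsingleton_ext ⟨B, B', b, g, h⟩ T n

theorem mainTheorem8 (R : Type u) [Ring R] (F : RFun.{u} R) (hF : F.IsFP) :
    (RFun.lift.obj F).IsReflexive ∧
      ∀ (M : ModuleCat.{u} Rᵐᵒᵖ) (i : ℕ), 0 < i →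
        Subsingleton (Abelian.Ext.{u + 1} F ((RFun.quasiCoherent R).obj M) i) :=
  ⟨(mainTheorem8_general R F hF).1, fun _ => (mainTheorem8_general R F hF).2 _⟩
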